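/- **Setting.** Let $(\Omega,P)$ be a probability space carrying a treatment $T\in\mathbb R^{d_T}$, covariates $X\in\mathbb R^{d_X}$, real potential outcomes $Y(t)$, $t\in\mathbb R^{d_T}$, and the observed outcome $Y=Y(T)$. Write $P_T,P_X$ for the laws of $T,X$, and $\mathcal T,\mathcal X$ for their supports. Assume ignorability: for every $t\in\mathcal T$, $Y(t)$ and $T$ are conditionally independent given $X$. Let $P_{Y|T,X}$ be a Markov kernel $(t,x)\mapsto P_{Y|T,X}(\cdot\mid t,x)$ which is a regular conditional law of $Y$ given $(T,X)$, in the version for which, for $P_T$-almost every $t$, $P_{Y|T,X}(\cdot\mid t,x)$ is the conditional law of $Y(t)$ given $X=x$. Put $$\tau(t,x)=\int y\,P_{Y|T,X}(dy\mid t,x),\qquad \mu(t)=E[Y(t)],\qquad Q_{T,X}=P_T\otimes P_X,$$ and assume $E_Q[Y^2]<\infty$ under $Q=P_T\otimes P_X\otimes P_{Y|T,X}$. The causal risk of $g:\mathbb R^{d_T}\to\mathbb R$ is $R(g)=E_{P_T}[(\mu(T)-g(T))^2]$. For a class $\mathcal F$ of measurable $Q_{T,X}$-integrable functions of $(t,x)$,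 put $\mathrm{IPM}_{\mathcal F}(P_0,Q_0)=\sup_{f\in\mathcal F}|E_{P_0}f-E_{Q_0}f|\in[0,\infty]$. A function $h$ is $(\gamma,\epsilon)$-approximable by $\mathcal F$ if there are $k\ge 0$, $f_1,\dots,f_k\in\mathcal F$ and $\lambda\in\mathbb R^k$ with $\sum_i|\lambda_i|\le\gamma$ and $|h-\sum_i\lambda_if_i|\le\epsilon$ on $\mathcal T\times\mathcal X$. A class $\mathcal G$ of measurable functions of $t$ is $B$-bounded if $|g-g'|\le B$ on $\mathcal T$ for all $g,g'\in\mathcal G$. **Theorem.** Assume that for every $g\in\mathcal G$ the function $-2\tau g+g^2$ is $(\gamma/2,\epsilon/2)$-approximable by $\mathcal F$, and that $\mathcal G$ is $B$-bounded. Fix $n\ge1$, data $(T_i,X_i)\in\mathcal T\times\mathcal X$, $1\le i\le n$, and constants $M,\sigma\ge0$ such that for every $i$ the law $P_{Y|T,X}(\cdot\mid T_i,X_i)$ has variance at most $\sigma^2$ and satisfies $|y-\tau(T_i,X_i)|\le M/2$ almost surely. Let $w$ be weights with $w_i\ge0$, $\sum_iw_i=1$ and $w_i\le W/n$ for all $i$,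 and let $\delta\in(0,1]$. Let the outcomes $Y_i$ be independent with $Y_i\sim P_{Y|T,X}(\cdot\mid T_i,X_i)$. Then, with probability at least $1-\delta$ over $(Y_1,\dots,Y_n)$, every minimizer $\hat g\in\mathcal G$ of the weighted empirical risk $g\mapsto\sum_iw_i(Y_i-g(T_i))^2$ over $\mathcal G$ satisfies $$R(\hat g)\le\inf_{g\in\mathcal G}R(g)+WM\Big(R_n(\mathcal G)+\frac{B_\delta^2}{12Bn}\Big)+\gamma\,\mathrm{IPM}_{\mathcal F}\Big(\sum_iw_i\delta_{(T_i,X_i)},\,Q_{T,X}\Big)+\sigma B_\delta\|w\|_2+2\epsilon,$$ where $B_\delta=4B\sqrt{2\log(1/\delta)}$, $R_n(\mathcal G)=\frac2n E_\xi\big[\sup_{g\in\mathcal G}\sum_i\xi_ig(T_i)\big]$ with $\xi_1,\dots,\xi_n$ i.i.d. uniform on $\{-1,1\}$, and the term $B_\delta^2/(12Bn)$ is read as $0$ when $B=0$. -/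

import Mathlib

open MeasureTheory ProbabilityTheory
open scoped ENNReal ProbabilityTheory

noncomputable section

namespace CausalBound

/-- Conditional independence of `U` and `V` given the random variable `S`, on an arbitrary probability
space: `P(U ∈ A, V ∈ B | S) = P(U ∈ A | S) P(V ∈ B | S)` a.s. for all measurable `A`, `B`.
(Mathlib's `CondIndepFun` is characterised by this identity, but it is only available when the
sample space is standard Borel.) -/
def CondIndepGiven {Ω α β γ : Type*} [MeasurableSpace Ω] [MeasurableSpace α] [MeasurableSpace β]
    [mγ : MeasurableSpace γ] (P : Measure Ω) (U : Ω → α) (V : Ω → β) (S : Ω → γ) : Prop :=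
  ∀ (A : Set α) (B : Set β), MeasurableSet A → MeasurableSet B →
    (P⟦U ⁻¹' A ∩ V ⁻¹' B | mγ.comap S⟧) =ᵐ[P]
      fun ω => (P⟦U ⁻¹' A | mγ.comap S⟧) ω * (P⟦V ⁻¹' B | mγ.comap S⟧) ω

section Model

variable {Ω 𝕋 𝕏 : Type*} [MeasurableSpace Ω] [MeasurableSpace 𝕋] [MeasurableSpace 𝕏]

/-- The observed outcome `Y = Y(T)`: the potential outcome at the observed treatment. -/
def observedOutcome (Ypot : 𝕋 → Ω → ℝ) (T : Ω → 𝕋) : Ω → ℝ :=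
  fun ω => Ypot (T ω) ω

/-- Ignorability: `Y(t)` and `T` are conditionally independent given `X`, for every `t` in the
support of the law of `T`. -/
def Ignorability [TopologicalSpace 𝕋] (P : Measure Ω) (T : Ω → 𝕋) (X : Ω → 𝕏)
    (Ypot : 𝕋 → Ω → ℝ) : Prop :=
  ∀ t ∈ (P.map T).support, CondIndepGiven P (Ypot t) T X

/-- `κ` is the outcome mechanism `P_{Y|T,X}`, as a kernel defined at every pair `(t, x)`.

* `observed`: `κ` is a regular conditional law of the observed outcome `Y = Y(T)` given `(T, X)`.
  This determines `κ` only up to null sets of the joint law of `(T, X)`, whereas the interventional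
  law `Q = P_T ⊗ P_X ⊗ P_{Y|T,X}` evaluates it at pairs which need not be typical for `(T, X)`.
* `potential`: which version is meant. For `P_T`-almost every `t`, the law `κ (t, x)` is that of the
  outcome `Y(t)`, of setting the treatment to `t`, given `X = x`. -/
structure IsOutcomeMechanism (P : Measure Ω) (T : Ω → 𝕋) (X : Ω → 𝕏) (Ypot : 𝕋 → Ω → ℝ)
    (κ : Kernel (𝕋 × 𝕏) ℝ) : Prop where
  observed : HasCondDistrib (observedOutcome Ypot T) (fun ω => (T ω, X ω)) κ P
  potential : ∀ᵐ t ∂(P.map T),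
    HasCondDistrib (Ypot t) X (κ.comap (fun x => (t, x)) measurable_prodMk_left) P

/-- The target law `Q_{T,X} = P_T ⊗ P_X`. -/
def targetLaw (P : Measure Ω) (T : Ω → 𝕋) (X : Ω → 𝕏) : Measure (𝕋 × 𝕏) :=
  (P.map T).prod (P.map X)

/-- The interventional law `Q = P_T ⊗ P_X ⊗ P_{Y|T,X}` of `((T, X), Y)`. -/
def interventionalLaw (P : Measure Ω) (T : Ω → 𝕋) (X : Ω → 𝕏) (κ : Kernel (𝕋 × 𝕏) ℝ) :
    Measure ((𝕋 × 𝕏) × ℝ) :=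
  (targetLaw P T X) ⊗ₘ κ

/-- The response function `τ(t, x) = E[Y | T = t, X = x]`. -/
def response (κ : Kernel (𝕋 × 𝕏) ℝ) (z : 𝕋 × 𝕏) : ℝ :=
  ∫ y, y ∂(κ z)

/-- The dose-response function `μ(t) = E[Y(t)]`. -/
def doseResponse (P : Measure Ω) (Ypot : 𝕋 → Ω → ℝ) (t : 𝕋) : ℝ :=
  ∫ ω, Ypot t ω ∂P

/-- The causal risk `R(g) = E_{T ∼ P_T}[(μ(T) - g(T))²]`; recall that `Q_T = P_T`. -/
def causalRisk (P : Measure Ω) (T : Ω → 𝕋) (Ypot : 𝕋 → Ω → ℝ) (g : 𝕋 → ℝ) : ℝ :=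
  ∫ t, (doseResponse P Ypot t - g t) ^ 2 ∂(P.map T)

end Model

section Learning

/-- The integral probability metric `sup_{f ∈ F} |E_{P₀} f - E_{Q₀} f|`, with values in `[0, ∞]`. -/
def IPM {α : Type*} [MeasurableSpace α] (F : Set (α → ℝ)) (P₀ Q₀ : Measure α) : ℝ≥0∞ :=
  ⨆ f ∈ F, ENNReal.ofReal |∫ a, f a ∂P₀ - ∫ a, f a ∂Q₀|

/-- The function `h` is `(γ, ε)`-approximable by the class `F` on the set `D`. -/
def Approximable {α : Type*} (D : Set α) (F : Set (α → ℝ)) (γ ε : ℝ) (h : α → ℝ) : Prop :=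
  ∃ (k : ℕ) (f : Fin k → α → ℝ) (c : Fin k → ℝ), (∀ i, f i ∈ F) ∧ (∑ i, |c i|) ≤ γ ∧
    ∀ a ∈ D, |h a - ∑ i, c i * f i a| ≤ ε

/-- The class `G` is `B`-bounded on `D`: any two of its members differ by at most `B` on `D`. -/
def IsBoundedClass {α : Type*} (D : Set α) (G : Set (α → ℝ)) (B : ℝ) : Prop :=
  ∀ g ∈ G, ∀ g' ∈ G, ∀ a ∈ D, |g a - g' a| ≤ B

/-- The weighted empirical distribution `∑ i, w i • δ_{z i}`. -/
def weightedEmpirical {α : Type*} [MeasurableSpace α] {n : ℕ} (w : Fin n → ℝ) (z : Fin n → α) :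
    Measure α :=
  ∑ i, ENNReal.ofReal (w i) • Measure.dirac (z i)

/-- `(2 / n) E_ξ[sup_{g ∈ G} ∑ i, ξ i g(t i)]`, where `ξ` is uniform on `{-1, 1}ⁿ`, that is, the
`ξ i` are i.i.d. Rademacher variables. -/
def rademacherComplexity {α : Type*} {n : ℕ} (G : Set (α → ℝ)) (t : Fin n → α) : ℝ :=
  2 / (n : ℝ) * ((2 ^ n : ℝ)⁻¹ *
    ∑ ξ : Fin n → ℤˣ, ⨆ g : G, ∑ i, (((ξ i : ℤˣ) : ℤ) : ℝ) * (g : α → ℝ) (t i))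

/-- The weighted empirical risk `∑ i, w i (y i - g(t i))²`. -/
def weightedRisk {α : Type*} {n : ℕ} (w : Fin n → ℝ) (t : Fin n → α) (y : Fin n → ℝ)
    (g : α → ℝ) : ℝ :=
  ∑ i, w i * (y i - g (t i)) ^ 2

/-- The joint law of the outcomes `Y₁, …, Yₙ` when `(Tᵢ, Xᵢ) = z i` are fixed: independent, with
`Yᵢ` distributed according to `κ (z i)`. -/
def outcomesLaw {α : Type*} [MeasurableSpace α] {n : ℕ} (κ : Kernel α ℝ) (z : Fin n → α) :
    Measure (Fin n → ℝ) :=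
  Measure.pi fun i => κ (z i)

/-- `B_δ = 4 B √(2 log(1/δ))`. -/
def Bdelta (B δ : ℝ) : ℝ :=
  4 * B * √(2 * Real.log (1 / δ))

end Learning

end CausalBound

end

namespace CausalBound

section Concentration

theorem integrable_of_continuous_of_ae_mem_isCompact {E : Type*} [TopologicalSpace E] [T2Space E]
    [MeasurableSpace E] [OpensMeasurableSpace E] {μ : Measure E} [IsFiniteMeasure μ] {K : Set E}
    (hK : IsCompact K) (hμ : ∀ᵐ a ∂μ, a ∈ K) {f : E → ℝ} (hf : Continuous f) :
    Integrable f μ := by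
  have h : IntegrableOn f K μ := hf.continuousOn.integrableOn_compact hK
  rwa [IntegrableOn, Measure.restrict_eq_self_of_ae_mem hμ] at h

/-- A function that is Lipschitz in each coordinate is continuous. -/
theorem continuous_of_abs_sub_le_sum {ι : Type*} [Fintype ι] {Z : (ι → ℝ) → ℝ} {c : ι → ℝ}
    (hZ : ∀ y y', |Z y - Z y'| ≤ ∑ i, c i * |y i - y' i|) : Continuous Z := by
  rw [continuous_iff_continuousAt]
  intro y
  rw [ContinuousAt, tendsto_iff_dist_tendsto_zero]
  have h : Filter.Tendsto (fun y' : ι → ℝ => ∑ i, c i * |y' i - y i|) (nhds y) (nhds 0) := by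
    have : Continuous (fun y' : ι → ℝ => ∑ i, c i * |y' i - y i|) := by fun_prop
    simpa using this.tendsto y
  refine squeeze_zero (fun _ => dist_nonneg) (fun y' => ?_) h
  rw [Real.dist_eq]
  exact hZ y' y

theorem mem_Icc_of_abs_sub_le {y m r : ℝ} (h : |y - m| ≤ r) : y ∈ Set.Icc (m - r) (m + r) := by
  rw [abs_le] at h
  constructor <;> linarith [h.1, h.2]

/-- Bernstein's bound on the moment generating function of a Lipschitz function of a bounded
variable. -/
theorem integral_exp_lipschitz_le (ν : Measure ℝ) [IsProbabilityMeasure ν] {r σ c l : ℝ}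
    (hν : ∀ᵐ y ∂ν, |y - ∫ x, x ∂ν| ≤ r) (hvar : Var[id; ν] ≤ σ ^ 2)
    {f : ℝ → ℝ} (hc : 0 ≤ c) (hf : ∀ y y', |f y - f y'| ≤ c * |y - y'|)
    (hl : 0 ≤ l) (hlc : l * (c * (2 * r)) ≤ 1) :
    ∫ y, Real.exp (l * f y) ∂ν ≤ Real.exp (l * ∫ y, f y ∂ν + l ^ 2 * (c ^ 2 * σ ^ 2)) := by
  set m := ∫ x, x ∂ν with hm
  have hK : ∀ᵐ y ∂ν, y ∈ Set.Icc (m - r) (m + r) := hν.mono fun y => mem_Icc_of_abs_sub_le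
  have int {g : ℝ → ℝ} (hg : Continuous g) : Integrable g ν :=
    integrable_of_continuous_of_ae_mem_isCompact isCompact_Icc hK hg
  have hfc : Continuous f := by
    refine (LipschitzWith.of_dist_le_mul (K := ⟨c, hc⟩) fun y y' => ?_).continuous
    exact hf y y'
  set a := ∫ y, f y ∂ν with ha
  have hdev : ∀ᵐ y ∂ν, |l * (f y - a)| ≤ 1 := by
    filter_upwards [hν] with y hy
    have h1 : |f y - a| ≤ c * (2 * r) := by
      have : f y - a = ∫ y', (f y - f y') ∂ν := by
        rw [integral_sub (integrable_const _) (int hfc)]; simp [ha]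
      rw [this]
      have hae : ∀ᵐ y' ∂ν, ‖f y - f y'‖ ≤ c * (2 * r) := by
        filter_upwards [hν] with y' hy'
        refine (hf y y').trans (mul_le_mul_of_nonneg_left ?_ hc)
        rw [abs_le] at *
        constructor <;> linarith [hy.1, hy.2, hy'.1, hy'.2]
      simpa using norm_integral_le_of_norm_le_const hae
    rw [abs_mul, abs_of_nonneg hl]
    exact (mul_le_mul_of_nonneg_left h1 hl).trans hlc
  have hvarf : ∫ y, (f y - a) ^ 2 ∂ν ≤ c ^ 2 * σ ^ 2 := by
    have e1 : ∫ y, (f y - a) ^ 2 ∂ν = Var[fun y => f y - f m; ν] := by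
      rw [variance_eq_integral (by fun_prop), integral_sub (int hfc) (integrable_const _)]
      simp [ha]
    rw [e1]
    refine (variance_le_expectation_sq (by fun_prop)).trans ?_
    have e2 : Var[id; ν] = ∫ y, (y - m) ^ 2 ∂ν := by
      rw [variance_eq_integral (by fun_prop)]; simp [hm]
    calc ∫ y, ((fun y => f y - f m) ^ 2) y ∂ν ≤ ∫ y, c ^ 2 * (y - m) ^ 2 ∂ν := by
          refine integral_mono (int ((hfc.sub continuous_const).pow 2))
            (int (by fun_prop)) fun y => ?_
          have := pow_le_pow_left₀ (abs_nonneg _) (hf y m) 2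
          simpa [mul_pow] using this
      _ = c ^ 2 * Var[id; ν] := by rw [integral_const_mul, e2]
      _ ≤ _ := mul_le_mul_of_nonneg_left hvar (sq_nonneg c)
  have hexp : ∫ y, Real.exp (l * (f y - a)) ∂ν ≤ Real.exp (l ^ 2 * (c ^ 2 * σ ^ 2)) := by
    calc ∫ y, Real.exp (l * (f y - a)) ∂ν
        ≤ ∫ y, (1 + l * (f y - a) + l ^ 2 * (f y - a) ^ 2) ∂ν := by
          refine integral_mono_ae (int (by fun_prop)) (int (by fun_prop)) ?_
          filter_upwards [hdev] with y hy
          have := (abs_le.1 (Real.abs_exp_sub_one_sub_id_le hy)).2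
          nlinarith
      _ = 1 + l ^ 2 * ∫ y, (f y - a) ^ 2 ∂ν := by
          rw [integral_add (int (by fun_prop)) (int (by fun_prop)),
            integral_add (int (by fun_prop)) (int (by fun_prop)), integral_const_mul,
            integral_const_mul, integral_sub (int hfc) (integrable_const _)]
          simp [ha]
      _ ≤ 1 + l ^ 2 * (c ^ 2 * σ ^ 2) := by gcongr
      _ ≤ _ := by rw [add_comm]; exact Real.add_one_le_exp _
  have e3 : ∀ y, Real.exp (l * f y) = Real.exp (l * a) * Real.exp (l * (f y - a)) := by
    intro y; rw [← Real.exp_add]; ring_nf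
  simp_rw [e3]
  rw [integral_const_mul, Real.exp_add]
  exact mul_le_mul_of_nonneg_left hexp (Real.exp_pos _).le

theorem ae_pi_forall_abs_sub_le {n : ℕ} (ν : Fin n → Measure ℝ) [∀ i, IsProbabilityMeasure (ν i)]
    {m : Fin n → ℝ} {r : ℝ} (hν : ∀ i, ∀ᵐ y ∂(ν i), |y - m i| ≤ r) :
    ∀ᵐ y ∂(Measure.pi ν), ∀ i, |y i - m i| ≤ r :=
  ae_all_iff.2 fun i => (Measure.quasiMeasurePreserving_eval ν i).ae (hν i)

theorem integrable_pi_of_continuous {n : ℕ} (ν : Fin n → Measure ℝ)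
    [∀ i, IsProbabilityMeasure (ν i)] {m : Fin n → ℝ} {r : ℝ}
    (hν : ∀ i, ∀ᵐ y ∂(ν i), |y - m i| ≤ r) {f : (Fin n → ℝ) → ℝ} (hf : Continuous f) :
    Integrable f (Measure.pi ν) := by
  refine integrable_of_continuous_of_ae_mem_isCompact
    (isCompact_univ_pi fun i => isCompact_Icc (a := m i - r) (b := m i + r)) ?_ hf
  filter_upwards [ae_pi_forall_abs_sub_le ν hν] with y hy i _
  exact mem_Icc_of_abs_sub_le (hy i)

/-- Bernstein's bound on the moment generating function of a function of independent bounded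
variables that is Lipschitz in each coordinate. -/
theorem integral_exp_pi_le {n : ℕ} (ν : Fin n → Measure ℝ) [∀ i, IsProbabilityMeasure (ν i)]
    {r σ l : ℝ} (hν : ∀ i, ∀ᵐ y ∂(ν i), |y - ∫ x, x ∂(ν i)| ≤ r)
    (hvar : ∀ i, Var[id; ν i] ≤ σ ^ 2) (hl : 0 ≤ l) {c : Fin n → ℝ} (hc : ∀ i, 0 ≤ c i)
    (hlc : ∀ i, l * (c i * (2 * r)) ≤ 1) {Z : (Fin n → ℝ) → ℝ}
    (hZ : ∀ y y', |Z y - Z y'| ≤ ∑ i, c i * |y i - y' i|) :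
    ∫ y, Real.exp (l * Z y) ∂(Measure.pi ν)
      ≤ Real.exp (l * ∫ y, Z y ∂(Measure.pi ν) + l ^ 2 * (∑ i, c i ^ 2 * σ ^ 2)) := by
  induction n with
  | zero =>
    obtain ⟨z, rfl⟩ : ∃ z, Z = fun _ => z :=
      ⟨Z 0, funext fun y => congrArg Z (Subsingleton.elim _ _)⟩
    simp
  | succ n ih =>
    have hZc : Continuous Z := continuous_of_abs_sub_le_sum hZ
    set ν' : Fin n → Measure ℝ := fun j => ν j.succ with hν'
    set ρ := Measure.pi ν' with hρ
    have mp : MeasurePreserving (fun p : ℝ × (Fin n → ℝ) => (Fin.cons p.1 p.2 : Fin (n + 1) → ℝ))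
        ((ν 0).prod ρ) (Measure.pi ν) := by
      have := (measurePreserving_piFinSuccAbove ν 0).symm
      simp only [MeasurableEquiv.piFinSuccAbove_symm_apply, Fin.insertNthEquiv_zero] at this
      exact this
    have hemb : MeasurableEmbedding
        (fun p : ℝ × (Fin n → ℝ) => (Fin.cons p.1 p.2 : Fin (n + 1) → ℝ)) := by
      have := (MeasurableEquiv.piFinSuccAbove (fun _ : Fin (n + 1) => ℝ) 0).symm.measurableEmbedding
      simp only [MeasurableEquiv.piFinSuccAbove_symm_apply, Fin.insertNthEquiv_zero] at this
      exact this
    have hcons : Continuous fun p : ℝ × (Fin n → ℝ) => (Fin.cons p.1 p.2 : Fin (n + 1) → ℝ) := by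
      refine continuous_pi fun i => ?_
      refine Fin.cases ?_ (fun j => ?_) i
      · simpa using continuous_fst
      · simp only [Fin.cons_succ]; fun_prop
    set Z' : ℝ × (Fin n → ℝ) → ℝ := fun p => Z (Fin.cons p.1 p.2) with hZ'
    have hZ'c : Continuous Z' := hZc.comp hcons
    have hae : ∀ᵐ p ∂((ν 0).prod ρ), p ∈ Set.Icc ((∫ x, x ∂(ν 0)) - r) ((∫ x, x ∂(ν 0)) + r) ×ˢ
        Set.univ.pi fun i => Set.Icc ((∫ x, x ∂(ν' i)) - r) ((∫ x, x ∂(ν' i)) + r) := by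
      have h := mp.quasiMeasurePreserving.ae (ae_pi_forall_abs_sub_le ν hν)
      filter_upwards [h] with p hp
      refine ⟨mem_Icc_of_abs_sub_le (by simpa using hp 0), fun i _ => ?_⟩
      exact mem_Icc_of_abs_sub_le (by simpa using hp i.succ)
    have int {g : ℝ × (Fin n → ℝ) → ℝ} (hg : Continuous g) : Integrable g ((ν 0).prod ρ) :=
      integrable_of_continuous_of_ae_mem_isCompact
        (isCompact_Icc.prod (isCompact_univ_pi fun i => isCompact_Icc)) hae hg
    have int0 {g : ℝ → ℝ} (hg : Continuous g) : Integrable g (ν 0) :=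
      integrable_of_continuous_of_ae_mem_isCompact isCompact_Icc
        ((hν 0).mono fun y => mem_Icc_of_abs_sub_le) hg
    have hlip0 : ∀ y' a b, |Z' (a, y') - Z' (b, y')| ≤ c 0 * |a - b| := by
      intro y' a b
      refine (hZ _ _).trans ?_
      simp [Fin.sum_univ_succ]
    have hlip' : ∀ a y y', |Z' (a, y) - Z' (a, y')| ≤ ∑ j, c (Fin.succ j) * |y j - y' j| := by
      intro a y y'
      refine (hZ _ _).trans ?_
      simp [Fin.sum_univ_succ]
    set Zb : (Fin n → ℝ) → ℝ := fun y' => ∫ a, Z' (a, y') ∂(ν 0) with hZb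
    have hZblip : ∀ y y', |Zb y - Zb y'| ≤ ∑ j, c (Fin.succ j) * |y j - y' j| := by
      intro y y'
      rw [hZb, ← integral_sub (int0 (by fun_prop)) (int0 (by fun_prop))]
      have := norm_integral_le_of_norm_le_const (μ := ν 0)
        (f := fun a => Z' (a, y) - Z' (a, y')) (.of_forall fun a => hlip' a y y')
      simpa using this
    have hZbc : Continuous Zb := continuous_of_abs_sub_le_sum hZblip
    have hmean : ∫ y, Z y ∂(Measure.pi ν) = ∫ y', Zb y' ∂ρ := by
      rw [← mp.integral_comp hemb, integral_prod_symm _ (int hZ'c)]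
    have hexp : ∫ y, Real.exp (l * Z y) ∂(Measure.pi ν)
        = ∫ y', ∫ a, Real.exp (l * Z' (a, y')) ∂(ν 0) ∂ρ := by
      rw [← mp.integral_comp hemb,
        integral_prod_symm (fun p => Real.exp (l * Z' p)) (int (by fun_prop))]
    rw [hexp, hmean]
    have hIH := ih ν' (fun j => hν j.succ) (fun j => hvar j.succ) (fun j => hc j.succ)
      (fun j => hlc j.succ) hZblip
    calc ∫ y', ∫ a, Real.exp (l * Z' (a, y')) ∂(ν 0) ∂ρ
        ≤ ∫ y', Real.exp (l ^ 2 * (c 0 ^ 2 * σ ^ 2)) * Real.exp (l * Zb y') ∂ρ := by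
          refine integral_mono_of_nonneg
            (.of_forall fun y' => integral_nonneg fun a => (Real.exp_pos _).le)
            ((integrable_pi_of_continuous ν' (fun j => hν j.succ) (by fun_prop)).const_mul _)
            (.of_forall fun y' => ?_)
          simp only
          rw [← Real.exp_add, add_comm (l ^ 2 * _)]
          exact integral_exp_lipschitz_le (ν 0) (hν 0) (hvar 0) (hc 0) (hlip0 y') hl (hlc 0)
      _ = Real.exp (l ^ 2 * (c 0 ^ 2 * σ ^ 2)) * ∫ y', Real.exp (l * Zb y') ∂ρ :=
          integral_const_mul _ _
      _ ≤ _ := by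
          refine (mul_le_mul_of_nonneg_left hIH (Real.exp_pos _).le).trans (le_of_eq ?_)
          rw [← Real.exp_add, Fin.sum_univ_succ]
          congr 1
          ring

/-- Bernstein's inequality for a function of independent bounded variables that is Lipschitz in
each coordinate. -/
theorem measureReal_pi_ge_le {n : ℕ} (ν : Fin n → Measure ℝ) [∀ i, IsProbabilityMeasure (ν i)]
    {r σ b v L s : ℝ} (hν : ∀ i, ∀ᵐ y ∂(ν i), |y - ∫ x, x ∂(ν i)| ≤ r)
    (hvar : ∀ i, Var[id; ν i] ≤ σ ^ 2) {c : Fin n → ℝ} (hc : ∀ i, 0 ≤ c i)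
    (hb : 0 < b) (hcb : ∀ i, c i * (2 * r) ≤ b) (hv : ∑ i, c i ^ 2 * σ ^ 2 = v)
    {Z : (Fin n → ℝ) → ℝ} (hZ : ∀ y y', |Z y - Z y'| ≤ ∑ i, c i * |y i - y' i|)
    (hL : 0 ≤ L) (hs : 2 * √(v * L) + b * L ≤ s) :
    (Measure.pi ν).real {y | ∫ y, Z y ∂(Measure.pi ν) + s ≤ Z y} ≤ Real.exp (-L) := by
  have hv0 : 0 ≤ v := hv ▸ Finset.sum_nonneg fun i _ => by positivity
  have hZc : Continuous Z := continuous_of_abs_sub_le_sum hZ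
  obtain ⟨l, hl, hlb, hls⟩ : ∃ l, 0 ≤ l ∧ l * b ≤ 1 ∧ L + l ^ 2 * v ≤ l * s := by
    by_cases h : L * b ^ 2 ≤ v
    · rcases hv0.eq_or_lt with h0 | h0
      · refine ⟨0, le_rfl, by simp, ?_⟩
        have : L * b ^ 2 = 0 := le_antisymm (h0 ▸ h) (by positivity)
        have : L = 0 := by simpa [hb.ne'] using this
        simp [this]
      · refine ⟨√(L / v), Real.sqrt_nonneg _, ?_, ?_⟩
        · rw [← Real.sqrt_sq hb.le, ← Real.sqrt_mul (by positivity), Real.sqrt_le_one,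
            div_mul_eq_mul_div, div_le_one h0]
          exact h
        · rw [Real.sq_sqrt (by positivity), div_mul_cancel₀ _ h0.ne']
          have e : √(L / v) * √(v * L) = L := by
            rw [← Real.sqrt_mul (by positivity)]
            have : L / v * (v * L) = L ^ 2 := by field_simp
            rw [this, Real.sqrt_sq hL]
          have := mul_le_mul_of_nonneg_left hs (Real.sqrt_nonneg (L / v))
          have h2 : 0 ≤ √(L / v) * (b * L) := by positivity
          nlinarith
    · push Not at h
      refine ⟨1 / b, by positivity, by field_simp; rfl, ?_⟩
      have h1 : v ≤ √(v * L) * b := by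
        rw [← Real.sqrt_sq hb.le, ← Real.sqrt_mul (by positivity)]
        refine Real.le_sqrt_of_sq_le ?_
        nlinarith
      have h2 : 0 ≤ √(v * L) := Real.sqrt_nonneg _
      have : (1 / b) * s - (L + (1 / b) ^ 2 * v) = (b * s - b ^ 2 * L - v) / b ^ 2 := by
        field_simp
        ring
      have h3 : 0 ≤ (b * s - b ^ 2 * L - v) / b ^ 2 := by
        apply div_nonneg _ (by positivity)
        nlinarith
      linarith
  have h := measure_ge_le_exp_mul_mgf (μ := Measure.pi ν) (X := Z) (t := l)
    (∫ y, Z y ∂(Measure.pi ν) + s) hl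
    (integrable_pi_of_continuous ν hν (by fun_prop))
  refine h.trans ?_
  have hm := integral_exp_pi_le ν hν hvar hl hc (fun i =>
    (mul_le_mul_of_nonneg_left (hcb i) hl).trans hlb) hZ
  rw [hv] at hm
  refine (mul_le_mul_of_nonneg_left hm (Real.exp_pos _).le).trans ?_
  rw [← Real.exp_add]
  apply Real.exp_le_exp.2
  nlinarith

end Concentration

section Symmetrization

variable {α : Type*} {n : ℕ}

/-- The largest value of `∑ i, u i * (g (t i) - g' (t i))` over pairs `g`, `g'` from the class. -/
noncomputable def pairSup (G : Set (α → ℝ)) (t : Fin n → α) (u : Fin n → ℝ) : ℝ :=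
  ⨆ p : G × G, ∑ i, u i * ((p.1 : α → ℝ) (t i) - (p.2 : α → ℝ) (t i))

/-- The largest correlation of the signs `ξ` with a member of the class. -/
noncomputable def signSup (G : Set (α → ℝ)) (t : Fin n → α) (ξ : Fin n → ℤˣ) : ℝ :=
  ⨆ g : G, ∑ i, (((ξ i : ℤˣ) : ℤ) : ℝ) * (g : α → ℝ) (t i)

variable {G : Set (α → ℝ)} {t : Fin n → α} {B : ℝ}

theorem sum_mul_sub_le (hB : ∀ g ∈ G, ∀ g' ∈ G, ∀ i, |g (t i) - g' (t i)| ≤ B)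
    (u : Fin n → ℝ) {g g' : α → ℝ} (hg : g ∈ G) (hg' : g' ∈ G) :
    ∑ i, u i * (g (t i) - g' (t i)) ≤ ∑ i, B * |u i| := by
  refine Finset.sum_le_sum fun i _ => (le_abs_self _).trans ?_
  rw [abs_mul, mul_comm]
  exact mul_le_mul_of_nonneg_right (hB g hg g' hg' i) (abs_nonneg _)

theorem le_pairSup (hB : ∀ g ∈ G, ∀ g' ∈ G, ∀ i, |g (t i) - g' (t i)| ≤ B)
    (u : Fin n → ℝ) {g g' : α → ℝ} (hg : g ∈ G) (hg' : g' ∈ G) :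
    ∑ i, u i * (g (t i) - g' (t i)) ≤ pairSup G t u := by
  refine le_ciSup (f := fun p : G × G => ∑ i, u i * ((p.1 : α → ℝ) (t i) - (p.2 : α → ℝ) (t i)))
    ⟨∑ i, B * |u i|, ?_⟩ (⟨g, hg⟩, ⟨g', hg'⟩)
  rintro _ ⟨p, rfl⟩
  exact sum_mul_sub_le hB u p.1.2 p.2.2

theorem pairSup_le (hG : G.Nonempty) {u : Fin n → ℝ} {a : ℝ}
    (h : ∀ g ∈ G, ∀ g' ∈ G, ∑ i, u i * (g (t i) - g' (t i)) ≤ a) : pairSup G t u ≤ a := by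
  have := hG.to_subtype
  exact ciSup_le fun p => h _ p.1.2 _ p.2.2

theorem abs_pairSup_sub_le (hG : G.Nonempty)
    (hB : ∀ g ∈ G, ∀ g' ∈ G, ∀ i, |g (t i) - g' (t i)| ≤ B) (u u' : Fin n → ℝ) :
    |pairSup G t u - pairSup G t u'| ≤ ∑ i, B * |u i - u' i| := by
  have key : ∀ u u' : Fin n → ℝ,
      pairSup G t u ≤ pairSup G t u' + ∑ i, B * |u i - u' i| := by
    intro u u'
    refine pairSup_le hG fun g hg g' hg' => ?_
    have h1 := le_pairSup hB u' hg hg'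
    have h2 := sum_mul_sub_le hB (fun i => u i - u' i) hg hg'
    have h3 : ∑ i, u i * (g (t i) - g' (t i)) = ∑ i, u' i * (g (t i) - g' (t i))
        + ∑ i, (u i - u' i) * (g (t i) - g' (t i)) := by
      rw [← Finset.sum_add_distrib]
      exact Finset.sum_congr rfl fun i _ => by ring
    linarith
  have h1 := key u u'
  have h2 := key u' u
  simp_rw [abs_sub_comm (u' _) (u _)] at h2
  rw [abs_le]
  constructor <;> linarith

theorem le_signSup (hB : ∀ g ∈ G, ∀ g' ∈ G, ∀ i, |g (t i) - g' (t i)| ≤ B)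
    (ξ : Fin n → ℤˣ) {g : α → ℝ} (hg : g ∈ G) :
    ∑ i, (((ξ i : ℤˣ) : ℤ) : ℝ) * g (t i) ≤ signSup G t ξ := by
  refine le_ciSup (f := fun g : G => ∑ i, (((ξ i : ℤˣ) : ℤ) : ℝ) * (g : α → ℝ) (t i))
    ⟨∑ i, (((ξ i : ℤˣ) : ℤ) : ℝ) * g (t i) + ∑ i, B * |(((ξ i : ℤˣ) : ℤ) : ℝ)|, ?_⟩ ⟨g, hg⟩
  rintro _ ⟨g', rfl⟩
  have h := sum_mul_sub_le hB (fun i => (((ξ i : ℤˣ) : ℤ) : ℝ)) g'.2 hg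
  simp only [mul_sub, Finset.sum_sub_distrib] at h
  simp only
  linarith

theorem sum_prod_signs (q : Fin n → ℤˣ → ℝ) :
    ∑ ξ : Fin n → ℤˣ, ∏ i, q i (ξ i) = ∏ i, (q i 1 + q i (-1)) := by
  have h := Finset.prod_univ_sum (fun _ : Fin n => (Finset.univ : Finset ℤˣ)) q
  rw [Fintype.piFinset_univ] at h
  rw [← h]
  refine Finset.prod_congr rfl fun i _ => ?_
  rw [UnitsInt.univ, Finset.sum_pair (by decide)]

/-- The weights that represent `u ∈ [-1, 1]ⁿ` as a convex combination of sign vectors. -/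
noncomputable def signWeight (u : Fin n → ℝ) (ξ : Fin n → ℤˣ) : ℝ :=
  ∏ i, (1 + (((ξ i : ℤˣ) : ℤ) : ℝ) * u i) / 2

theorem sum_signWeight (u : Fin n → ℝ) : ∑ ξ, signWeight u ξ = 1 := by
  unfold signWeight
  rw [sum_prod_signs (fun i s => (1 + ((s : ℤ) : ℝ) * u i) / 2)]
  refine Finset.prod_eq_one fun i _ => ?_
  push_cast
  ring

theorem sum_signWeight_mul (u : Fin n → ℝ) (j : Fin n) :
    ∑ ξ, signWeight u ξ * (((ξ j : ℤˣ) : ℤ) : ℝ) = u j := by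
  have h := sum_prod_signs (fun i s => (1 + ((s : ℤ) : ℝ) * u i) / 2 *
    if i = j then ((s : ℤ) : ℝ) else 1)
  simp only [Finset.prod_mul_distrib] at h
  simp only [Finset.prod_ite_eq', Finset.mem_univ, if_true] at h
  unfold signWeight
  rw [h, Finset.prod_eq_single j]
  · simp; ring
  · intro i _ hi
    simp [hi]; ring
  · simp

theorem signWeight_nonneg {u : Fin n → ℝ} (hu : ∀ i, |u i| ≤ 1) (ξ : Fin n → ℤˣ) :
    0 ≤ signWeight u ξ := by
  refine Finset.prod_nonneg fun i _ => ?_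
  have h := abs_le.1 (hu i)
  rcases Int.units_eq_one_or (ξ i) with h1 | h1 <;> simp [h1] <;> linarith

theorem pairSup_le_sum_signWeight (hG : G.Nonempty)
    (hB : ∀ g ∈ G, ∀ g' ∈ G, ∀ i, |g (t i) - g' (t i)| ≤ B) {a : ℝ} (ha : 0 ≤ a)
    {u : Fin n → ℝ} (hu : ∀ i, |u i| ≤ 1) :
    pairSup G t (fun i => a * u i)
      ≤ ∑ ξ, signWeight u ξ * (a * (signSup G t ξ + signSup G t (-ξ))) := by
  refine pairSup_le hG fun g hg g' hg' => ?_
  calc ∑ i, a * u i * (g (t i) - g' (t i))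
      = ∑ i, ∑ ξ, signWeight u ξ * (a * ((((ξ i : ℤˣ) : ℤ) : ℝ) * g (t i)
          + ((((-ξ) i : ℤˣ) : ℤ) : ℝ) * g' (t i))) := by
        refine Finset.sum_congr rfl fun i _ => ?_
        rw [← sum_signWeight_mul u i, Finset.mul_sum, Finset.sum_mul]
        refine Finset.sum_congr rfl fun ξ _ => ?_
        simp only [Pi.neg_apply, Units.val_neg, Int.cast_neg]
        ring
    _ = ∑ ξ, signWeight u ξ * (a * (∑ i, (((ξ i : ℤˣ) : ℤ) : ℝ) * g (t i)
          + ∑ i, ((((-ξ) i : ℤˣ) : ℤ) : ℝ) * g' (t i))) := by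
        rw [Finset.sum_comm]
        refine Finset.sum_congr rfl fun ξ _ => ?_
        rw [← Finset.sum_add_distrib, Finset.mul_sum, Finset.mul_sum]
    _ ≤ _ := by
        refine Finset.sum_le_sum fun ξ _ => mul_le_mul_of_nonneg_left
          (mul_le_mul_of_nonneg_left ?_ ha) (signWeight_nonneg hu ξ)
        exact add_le_add (le_signSup hB ξ hg) (le_signSup hB (-ξ) hg')

theorem integral_signWeight (ν : Fin n → Measure ℝ) [∀ i, IsProbabilityMeasure (ν i)]
    {m c : Fin n → ℝ} (hint : ∀ i, Integrable (fun y => y) (ν i)) (hm : ∀ i, ∫ y, y ∂(ν i) = m i)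
    (ξ : Fin n → ℤˣ) :
    Integrable (fun y => signWeight (fun i => c i * (y i - m i)) ξ) (Measure.pi ν) ∧
      ∫ y, signWeight (fun i => c i * (y i - m i)) ξ ∂(Measure.pi ν) = (2 ^ n : ℝ)⁻¹ := by
  have hi : ∀ i, Integrable
      (fun y : ℝ => (1 + (((ξ i : ℤˣ) : ℤ) : ℝ) * (c i * (y - m i))) / 2) (ν i) := fun i =>
    ((integrable_const _).add ((((hint i).sub (integrable_const _)).const_mul _).const_mul _)
      ).div_const _
  refine ⟨Integrable.fintype_prod hi, ?_⟩
  unfold signWeight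
  rw [integral_fintype_prod_eq_prod
    (fun i (y : ℝ) => (1 + (((ξ i : ℤˣ) : ℤ) : ℝ) * (c i * (y - m i))) / 2)]
  have : ∀ i, ∫ y, (1 + (((ξ i : ℤˣ) : ℤ) : ℝ) * (c i * (y - m i))) / 2 ∂(ν i) = 2⁻¹ := by
    intro i
    have h1 : Integrable (fun y => y - m i) (ν i) := (hint i).sub (integrable_const _)
    rw [integral_div, integral_add (integrable_const _)
      ((h1.const_mul _).const_mul _), integral_const_mul,
      integral_const_mul, integral_sub (hint i) (integrable_const _)]
    simp [hm i]
  simp [this]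

theorem sum_signSup_neg (G : Set (α → ℝ)) (t : Fin n → α) :
    ∑ ξ : Fin n → ℤˣ, signSup G t (-ξ) = ∑ ξ, signSup G t ξ :=
  Equiv.sum_comp (Equiv.neg (Fin n → ℤˣ)) (signSup G t)

theorem sum_signSup_nonneg (hG : G.Nonempty)
    (hB : ∀ g ∈ G, ∀ g' ∈ G, ∀ i, |g (t i) - g' (t i)| ≤ B) :
    0 ≤ ∑ ξ, signSup G t ξ := by
  obtain ⟨g, hg⟩ := hG
  have h : 0 ≤ ∑ ξ : Fin n → ℤˣ, (signSup G t ξ + signSup G t (-ξ)) := by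
    refine Finset.sum_nonneg fun ξ _ => ?_
    have h1 := add_le_add (le_signSup hB ξ hg) (le_signSup hB (-ξ) hg)
    simpa using h1
  rw [Finset.sum_add_distrib, sum_signSup_neg] at h
  linarith

/-- Symmetrization: the expected supremum over pairs of members of the class of the weighted
centred sums is controlled by the Rademacher averages. -/
theorem integral_pairSup_le (hG : G.Nonempty)
    (hB : ∀ g ∈ G, ∀ g' ∈ G, ∀ i, |g (t i) - g' (t i)| ≤ B)
    (ν : Fin n → Measure ℝ) [∀ i, IsProbabilityMeasure (ν i)] {r a : ℝ} (ha : 0 < a)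
    (hν : ∀ i, ∀ᵐ y ∂(ν i), |y - ∫ x, x ∂(ν i)| ≤ r) {w : Fin n → ℝ} (hw : ∀ i, 0 ≤ w i)
    (hwa : ∀ i, w i * r ≤ a) :
    ∫ y, pairSup G t (fun i => w i * (y i - ∫ x, x ∂(ν i))) ∂(Measure.pi ν)
      ≤ 2 * a * ((2 ^ n : ℝ)⁻¹ * ∑ ξ, signSup G t ξ) := by
  set m : Fin n → ℝ := fun i => ∫ x, x ∂(ν i) with hm
  have hint : ∀ i, Integrable (fun y => y) (ν i) := fun i =>
    integrable_of_continuous_of_ae_mem_isCompact isCompact_Icc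
      ((hν i).mono fun y => mem_Icc_of_abs_sub_le) continuous_id
  have hcont : Continuous fun y : Fin n → ℝ => pairSup G t (fun i => w i * (y i - m i)) := by
    have h : Continuous (pairSup G t) :=
      continuous_of_abs_sub_le_sum (c := fun _ => B) (abs_pairSup_sub_le hG hB)
    exact h.comp (by fun_prop)
  have hsw := integral_signWeight ν (c := fun i => w i / a) hint (fun i => rfl : ∀ i, _ = m i)
  calc ∫ y, pairSup G t (fun i => w i * (y i - m i)) ∂(Measure.pi ν)
      ≤ ∫ y, ∑ ξ, signWeight (fun i => w i / a * (y i - m i)) ξ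
          * (a * (signSup G t ξ + signSup G t (-ξ))) ∂(Measure.pi ν) := by
        refine integral_mono_ae (integrable_pi_of_continuous ν hν hcont)
          (integrable_finsetSum _ fun ξ _ => (hsw ξ).1.mul_const _) ?_
        filter_upwards [ae_pi_forall_abs_sub_le ν hν] with y hy
        have hu : ∀ i, |w i / a * (y i - m i)| ≤ 1 := by
          intro i
          rw [div_mul_eq_mul_div, abs_div, abs_mul, abs_of_pos ha, abs_of_nonneg (hw i),
            div_le_one ha]
          exact (mul_le_mul_of_nonneg_left (hy i) (hw i)).trans (hwa i)
        have := pairSup_le_sum_signWeight hG hB ha.le hu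
        have e : (fun i => a * (w i / a * (y i - m i))) = fun i => w i * (y i - m i) := by
          funext i; field_simp
        rwa [e] at this
    _ = ∑ ξ, (2 ^ n : ℝ)⁻¹ * (a * (signSup G t ξ + signSup G t (-ξ))) := by
        rw [integral_finsetSum _ fun ξ _ => (hsw ξ).1.mul_const _]
        refine Finset.sum_congr rfl fun ξ _ => ?_
        rw [integral_mul_const, (hsw ξ).2]
    _ = _ := by
        rw [← Finset.mul_sum, ← Finset.mul_sum, Finset.sum_add_distrib, sum_signSup_neg]
        ring

end Symmetrization

section Deviation

variable {α : Type*} {n : ℕ} {G : Set (α → ℝ)} {t : Fin n → α} {B : ℝ}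

/-- With probability at least `1 - δ`, the weighted noise is small uniformly over pairs of members
of the class. -/
theorem exists_event_noise_le (hn : 0 < n) (hG : G.Nonempty)
    (hB : ∀ g ∈ G, ∀ g' ∈ G, ∀ i, |g (t i) - g' (t i)| ≤ B)
    (ν : Fin n → Measure ℝ) [∀ i, IsProbabilityMeasure (ν i)] {M σ : ℝ} (hσ : 0 ≤ σ)
    (hν : ∀ i, ∀ᵐ y ∂(ν i), |y - ∫ x, x ∂(ν i)| ≤ M / 2) (hvar : ∀ i, Var[id; ν i] ≤ σ ^ 2)
    {w : Fin n → ℝ} (hw : w ∈ stdSimplex ℝ (Fin n)) {W : ℝ} (hW : ∀ i, w i ≤ W / n)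
    {δ : ℝ} (hδ : 0 < δ) (hδ1 : δ ≤ 1) :
    ∃ E : Set (Fin n → ℝ), MeasurableSet E ∧ ENNReal.ofReal (1 - δ) ≤ Measure.pi ν E ∧
      ∀ y ∈ E, ∀ g ∈ G, ∀ g' ∈ G,
        2 * ∑ i, w i * (y i - ∫ x, x ∂(ν i)) * (g (t i) - g' (t i))
          ≤ W * M * (rademacherComplexity G t + Bdelta B δ ^ 2 / (12 * B * n))
            + σ * Bdelta B δ * √(∑ i, w i ^ 2) := by
  have hn' : (0 : ℝ) < n := by exact_mod_cast hn
  have hB0 : 0 ≤ B := by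
    obtain ⟨g, hg⟩ := hG
    exact (abs_nonneg _).trans (hB g hg g hg ⟨0, hn⟩)
  have hM0 : 0 ≤ M := by
    obtain ⟨y, hy⟩ := (hν ⟨0, hn⟩).exists
    have := (abs_nonneg _).trans hy
    linarith
  have hW0 : 1 ≤ W := by
    have h := Finset.sum_le_sum fun i (_ : i ∈ Finset.univ) => hW i
    rw [hw.2] at h
    simpa [mul_div_cancel₀ W hn'.ne'] using h
  set L := Real.log (1 / δ) with hLdef
  have hL : 0 ≤ L := Real.log_nonneg (by rw [le_div_iff₀ hδ]; linarith)
  have hR : rademacherComplexity G t = 2 / (n : ℝ) * ((2 ^ n : ℝ)⁻¹ * ∑ ξ, signSup G t ξ) := rfl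
  have hR0 : 0 ≤ rademacherComplexity G t := by
    have := sum_signSup_nonneg hG hB
    rw [hR]
    positivity
  have hBd : 0 ≤ Bdelta B δ := by unfold Bdelta; positivity
  set m : Fin n → ℝ := fun i => ∫ x, x ∂(ν i) with hm
  rcases (mul_nonneg hB0 hM0).eq_or_lt with hBM | hBM
  · refine ⟨{y | ∀ i, |y i - m i| ≤ M / 2}, ?_, ?_, fun y hy g hg g' hg' => ?_⟩
    · rw [Set.ofPred_forall]
      exact MeasurableSet.iInter fun i => measurableSet_le (by fun_prop) measurable_const
    · have h : Measure.pi ν {y | ∀ i, |y i - m i| ≤ M / 2} = 1 :=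
        (measure_congr (Filter.eventuallyEq_univ.2 (ae_pi_forall_abs_sub_le ν hν))).trans measure_univ
      rw [h, ENNReal.ofReal_le_one]
      linarith
    · have h0 : ∑ i, w i * (y i - m i) * (g (t i) - g' (t i)) ≤ 0 := by
        refine Finset.sum_nonpos fun i _ => (le_abs_self _).trans ?_
        rw [abs_mul, abs_mul, abs_of_nonneg (hw.1 i), mul_assoc]
        have h1 : |y i - m i| * |g (t i) - g' (t i)| ≤ M / 2 * B :=
          mul_le_mul (hy i) (hB g hg g' hg' i) (abs_nonneg _) (by positivity)
        have h2 : M / 2 * B = 0 := by linarith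
        exact mul_nonpos_of_nonneg_of_nonpos (hw.1 i) (h1.trans h2.le)
      have : 0 ≤ W * M * (rademacherComplexity G t + Bdelta B δ ^ 2 / (12 * B * n))
            + σ * Bdelta B δ * √(∑ i, w i ^ 2) := by positivity
      linarith
  · have hBp : 0 < B := by
      rcases hB0.eq_or_lt with h | h
      · simp [← h] at hBM
      · exact h
    have hMp : 0 < M := pos_of_mul_pos_right hBM hB0
    have hWp : 0 < W := by linarith
    set Z : (Fin n → ℝ) → ℝ := fun y => 2 * pairSup G t (fun i => w i * (y i - m i)) with hZ
    have hZlip : ∀ y y', |Z y - Z y'| ≤ ∑ i, (2 * B * w i) * |y i - y' i| := by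
      intro y y'
      have h := abs_pairSup_sub_le hG hB (fun i => w i * (y i - m i)) (fun i => w i * (y' i - m i))
      rw [hZ]
      simp only
      rw [← mul_sub, abs_mul, abs_two]
      refine (mul_le_mul_of_nonneg_left h zero_le_two).trans (le_of_eq ?_)
      rw [Finset.mul_sum]
      refine Finset.sum_congr rfl fun i _ => ?_
      have : w i * (y i - m i) - w i * (y' i - m i) = w i * (y i - y' i) := by ring
      rw [this, abs_mul, abs_of_nonneg (hw.1 i)]
      ring
    have hZc : Continuous Z := continuous_of_abs_sub_le_sum hZlip
    set s := W * M * (Bdelta B δ ^ 2 / (12 * B * n)) + σ * Bdelta B δ * √(∑ i, w i ^ 2) with hs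
    have hEZ : ∫ y, Z y ∂(Measure.pi ν) ≤ W * M * rademacherComplexity G t := by
      have h := integral_pairSup_le hG hB ν (a := W * M / (2 * n)) (by positivity) hν hw.1
        (fun i => by
          refine (mul_le_mul_of_nonneg_right (hW i) (by positivity)).trans (le_of_eq ?_)
          field_simp)
      rw [hZ, integral_const_mul, hR]
      refine (mul_le_mul_of_nonneg_left h zero_le_two).trans (le_of_eq ?_)
      field_simp
    have htail := measureReal_pi_ge_le ν (b := 2 * (W * M * B) / n) (L := L) (s := s) hν hvar
      (c := fun i => 2 * B * w i) (fun i => mul_nonneg (by positivity) (hw.1 i)) (by positivity)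
      (fun i => by
        have := mul_le_mul_of_nonneg_right (hW i) hBM.le
        have e : W / n * (B * M) = W * M * B / n := by ring
        rw [e] at this
        rw [mul_div_assoc]
        linarith) rfl hZlip hL (by
        have e1 : ∑ i, (2 * B * w i) ^ 2 * σ ^ 2 = (2 * B * σ) ^ 2 * ∑ i, w i ^ 2 := by
          rw [Finset.mul_sum]
          exact Finset.sum_congr rfl fun i _ => by ring
        have e2 : √((2 * B * σ) ^ 2 * ∑ i, w i ^ 2) = 2 * B * σ * √(∑ i, w i ^ 2) := by
          rw [Real.sqrt_mul (by positivity), Real.sqrt_sq (by positivity)]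
        rw [e1, Real.sqrt_mul (mul_nonneg (sq_nonneg _)
          (Finset.sum_nonneg fun i _ => sq_nonneg _)), e2, hs]
        have e3 : Bdelta B δ ^ 2 = 32 * B ^ 2 * L := by
          unfold Bdelta
          rw [mul_pow, Real.sq_sqrt (by positivity)]
          ring
        have h4 : √L ≤ √(2 * L) := Real.sqrt_le_sqrt (by linarith)
        have h5 : 2 * (2 * B * σ * √(∑ i, w i ^ 2) * √L)
            ≤ σ * Bdelta B δ * √(∑ i, w i ^ 2) := by
          have := mul_le_mul_of_nonneg_left h4
            (show 0 ≤ 4 * B * σ * √(∑ i, w i ^ 2) by positivity)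
          unfold Bdelta
          rw [← hLdef]
          linarith
        have h6 : 2 * (W * M * B) / n * L ≤ W * M * (Bdelta B δ ^ 2 / (12 * B * n)) := by
          have e : W * M * (Bdelta B δ ^ 2 / (12 * B * n)) = (8 / 3) * (W * M * B / n * L) := by
            rw [e3]; field_simp; ring
          rw [e]
          have : 0 ≤ W * M * B / n * L := by positivity
          have e' : 2 * (W * M * B) / n * L = 2 * (W * M * B / n * L) := by ring
          linarith
        linarith)
    have hδL : Real.exp (-L) = δ := by
      rw [hLdef, one_div, Real.log_inv, neg_neg, Real.exp_log hδ]
    rw [hδL] at htail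
    have hmeas : MeasurableSet {y | ∫ y, Z y ∂(Measure.pi ν) + s ≤ Z y} :=
      measurableSet_le measurable_const hZc.measurable
    refine ⟨{y | ∫ y, Z y ∂(Measure.pi ν) + s ≤ Z y}ᶜ, hmeas.compl, ?_, fun y hy g hg g' hg' => ?_⟩
    · rw [← ofReal_measureReal, probReal_compl_eq_one_sub hmeas]
      exact ENNReal.ofReal_le_ofReal (by linarith)
    · simp only [Set.mem_compl_iff, Set.mem_ofPred_eq, not_le] at hy
      have h := le_pairSup hB (fun i => w i * (y i - m i)) hg hg'
      have hZy : Z y = 2 * pairSup G t (fun i => w i * (y i - m i)) := rfl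
      rw [hs] at hy
      linarith

end Deviation

section Approximation

theorem Approximable.nonneg_left {α : Type*} {D : Set α} {F : Set (α → ℝ)} {γ ε : ℝ} {h : α → ℝ}
    (hh : Approximable D F γ ε h) : 0 ≤ γ := by
  obtain ⟨k, f, c, -, hc, -⟩ := hh
  exact (Finset.sum_nonneg fun i _ => abs_nonneg _).trans hc

variable {α : Type*} [MeasurableSpace α]

theorem integral_weightedEmpirical {n : ℕ} {w : Fin n → ℝ} (hw : ∀ i, 0 ≤ w i) (z : Fin n → α)
    {f : α → ℝ} (hf : Measurable f) :
    ∫ a, f a ∂(weightedEmpirical w z) = ∑ i, w i * f (z i) := by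
  unfold weightedEmpirical
  rw [integral_finsetSum_measure]
  · refine Finset.sum_congr rfl fun i _ => ?_
    rw [integral_smul_measure, integral_dirac' _ _ hf.stronglyMeasurable,
      ENNReal.toReal_ofReal (hw i), smul_eq_mul]
  · intro i _
    refine Integrable.smul_measure ?_ ENNReal.ofReal_ne_top
    exact ((integrable_const (f (z i))).congr
      (by
        rw [Filter.EventuallyEq, ae_dirac_iff (measurableSet_eq_fun measurable_const hf)]))

theorem abs_integral_sub_le_IPM {F : Set (α → ℝ)} {P₀ Q₀ : Measure α} (h : IPM F P₀ Q₀ ≠ ∞)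
    {f : α → ℝ} (hf : f ∈ F) :
    |∫ a, f a ∂P₀ - ∫ a, f a ∂Q₀| ≤ (IPM F P₀ Q₀).toReal := by
  rw [← ENNReal.ofReal_le_iff_le_toReal h]
  exact le_iSup₂ (f := fun f (_ : f ∈ F) => ENNReal.ofReal |∫ a, f a ∂P₀ - ∫ a, f a ∂Q₀|) f hf

theorem Approximable.integrable {D : Set α} {F : Set (α → ℝ)} {γ ε : ℝ} {h : α → ℝ}
    (hh : Approximable D F γ ε h) (hm : Measurable h) {Q : Measure α} [IsFiniteMeasure Q]
    (hF : ∀ f ∈ F, Integrable f Q) (hD : ∀ᵐ a ∂Q, a ∈ D) : Integrable h Q := by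
  obtain ⟨k, f, c, hf, -, hfh⟩ := hh
  have hS : Integrable (fun a => ∑ i, c i * f i a) Q :=
    integrable_finsetSum _ fun i _ => (hF _ (hf i)).const_mul _
  have hd : Integrable (fun a => h a - ∑ i, c i * f i a) Q := by
    refine Integrable.of_bound (hm.aestronglyMeasurable.sub hS.1) ε ?_
    filter_upwards [hD] with a ha
    simpa using hfh a ha
  exact (hd.add hS).congr (.of_forall fun a => by simp)

/-- The discrepancy of an approximable function between the weighted sample and the target law is
controlled by the integral probability metric. -/
theorem Approximable.abs_sum_sub_integral_le {D : Set α} {F : Set (α → ℝ)} {γ ε : ℝ} {h : α → ℝ}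
    (hh : Approximable D F γ ε h) (hm : Measurable h) {Q : Measure α} [IsProbabilityMeasure Q]
    (hF : ∀ f ∈ F, Measurable f ∧ Integrable f Q) (hD : ∀ᵐ a ∂Q, a ∈ D) {n : ℕ}
    {w : Fin n → ℝ} (hw : w ∈ stdSimplex ℝ (Fin n)) {z : Fin n → α} (hz : ∀ i, z i ∈ D)
    (hI : γ = 0 ∨ IPM F (weightedEmpirical w z) Q ≠ ∞) :
    |∑ i, w i * h (z i) - ∫ a, h a ∂Q|
      ≤ γ * (IPM F (weightedEmpirical w z) Q).toReal + 2 * ε := by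
  have hint := hh.integrable hm (fun f hf => (hF f hf).2) hD
  obtain ⟨k, f, c, hf, hc, hfh⟩ := hh
  set S : α → ℝ := fun a => ∑ i, c i * f i a with hSdef
  have hS : Integrable S Q := integrable_finsetSum _ fun i _ => ((hF _ (hf i)).2).const_mul _
  set K := (IPM F (weightedEmpirical w z) Q).toReal with hK
  have hK0 : 0 ≤ K := ENNReal.toReal_nonneg
  have h1 : |∑ i, w i * h (z i) - ∑ i, w i * S (z i)| ≤ ε := by
    rw [← Finset.sum_sub_distrib]
    refine (Finset.abs_sum_le_sum_abs _ _).trans ?_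
    calc ∑ i, |w i * h (z i) - w i * S (z i)| ≤ ∑ i, w i * ε := by
          refine Finset.sum_le_sum fun i _ => ?_
          rw [← mul_sub, abs_mul, abs_of_nonneg (hw.1 i)]
          exact mul_le_mul_of_nonneg_left (hfh _ (hz i)) (hw.1 i)
      _ = ε := by rw [← Finset.sum_mul, hw.2, one_mul]
  have h2 : |∫ a, h a ∂Q - ∫ a, S a ∂Q| ≤ ε := by
    rw [← integral_sub hint hS]
    have := norm_integral_le_of_norm_le_const (μ := Q) (f := fun a => h a - S a) (C := ε)
      (by filter_upwards [hD] with a ha; exact hfh a ha)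
    simpa using this
  have h3 : |∑ i, w i * S (z i) - ∫ a, S a ∂Q| ≤ γ * K := by
    have e : ∑ i, w i * S (z i) - ∫ a, S a ∂Q
        = ∑ j, c j * (∫ a, f j a ∂(weightedEmpirical w z) - ∫ a, f j a ∂Q) := by
      rw [hSdef, integral_finsetSum _ fun i _ => ((hF _ (hf i)).2).const_mul _]
      simp_rw [integral_const_mul, mul_sub, Finset.sum_sub_distrib, Finset.mul_sum]
      rw [Finset.sum_comm]
      congr 1
      refine Finset.sum_congr rfl fun j _ => ?_
      rw [integral_weightedEmpirical hw.1 z (hF _ (hf j)).1, Finset.mul_sum]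
      exact Finset.sum_congr rfl fun i _ => by ring
    rw [e]
    refine (Finset.abs_sum_le_sum_abs _ _).trans ?_
    have h4 : ∀ j, |c j * (∫ a, f j a ∂(weightedEmpirical w z) - ∫ a, f j a ∂Q)|
        ≤ |c j| * K := by
      intro j
      rw [abs_mul]
      rcases hI with h0 | hI
      · have : |c j| ≤ 0 :=
          (Finset.single_le_sum (fun i _ => abs_nonneg (c i)) (Finset.mem_univ j)).trans
            (hc.trans h0.le)
        simp [abs_nonpos_iff.1 this]
      · exact mul_le_mul_of_nonneg_left (abs_integral_sub_le_IPM hI (hf j)) (abs_nonneg _)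
    refine (Finset.sum_le_sum fun j _ => h4 j).trans ?_
    rw [← Finset.sum_mul]
    exact mul_le_mul_of_nonneg_right hc hK0
  rw [abs_le] at *
  constructor <;> linarith [h1.1, h1.2, h2.1, h2.2, h3.1, h3.2]

end Approximation

section Risk

theorem sq_integral_le_integral_sq {α : Type*} [MeasurableSpace α] {μ : Measure α}
    [IsProbabilityMeasure μ] {f : α → ℝ} (hf : MemLp f 2 μ) :
    (∫ a, f a ∂μ) ^ 2 ≤ ∫ a, f a ^ 2 ∂μ := by
  have h := variance_nonneg f μ
  rw [variance_eq_sub hf] at h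
  simpa using h

theorem memLp_two_integral_kernel {α : Type*} [MeasurableSpace α] {Q : Measure α}
    [IsProbabilityMeasure Q] {κ : Kernel α ℝ} [IsMarkovKernel κ]
    (h2 : Integrable (fun p => p.2 ^ 2) (Q ⊗ₘ κ)) : MemLp (fun z => ∫ y, y ∂(κ z)) 2 Q := by
  have hm : AEStronglyMeasurable (fun z => ∫ y, y ∂(κ z)) Q :=
    (stronglyMeasurable_id.integral_kernel (κ := κ)).aestronglyMeasurable
  rw [memLp_two_iff_integrable_sq hm]
  obtain ⟨h3, h4⟩ := (Measure.integrable_compProd_iff h2.1).1 h2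
  refine h4.mono' (hm.pow 2) ?_
  filter_upwards [h3] with z hz
  have hid : MemLp (fun y : ℝ => y) 2 (κ z) :=
    (memLp_two_iff_integrable_sq aestronglyMeasurable_id).2 hz
  have h := sq_integral_le_integral_sq hid
  simpa using h

theorem memLp_two_integral_prod {α β : Type*} [MeasurableSpace α] [MeasurableSpace β]
    {μ : Measure α} {ν : Measure β} [IsProbabilityMeasure μ] [IsProbabilityMeasure ν]
    {f : α × β → ℝ} (hf : Measurable f) (hf2 : MemLp f 2 (μ.prod ν)) :
    MemLp (fun a => ∫ b, f (a, b) ∂ν) 2 μ := by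
  have hm : AEStronglyMeasurable (fun a => ∫ b, f (a, b) ∂ν) μ :=
    (hf.stronglyMeasurable.integral_prod_right' (ν := ν)).aestronglyMeasurable
  rw [memLp_two_iff_integrable_sq hm]
  have hi := hf2.integrable_sq
  refine hi.integral_prod_left.mono' (hm.pow 2) ?_
  filter_upwards [hi.prod_right_ae] with a ha
  have h := sq_integral_le_integral_sq ((memLp_two_iff_integrable_sq
    (hf.comp measurable_prodMk_left).aestronglyMeasurable).2 ha)
  simpa using h

/-- The squared distance from `g` to the average of `f`, in terms of `-2 f g + g²`. -/
theorem integral_sq_sub_eq {α β : Type*} [MeasurableSpace α] [MeasurableSpace β]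
    {μ : Measure α} {ν : Measure β} [IsProbabilityMeasure μ] [IsProbabilityMeasure ν]
    {f : α × β → ℝ} (hf : Measurable f) (hf2 : MemLp f 2 (μ.prod ν)) {g : α → ℝ}
    (hg : Measurable g)
    (hh : Integrable (fun z : α × β => -2 * f z * g z.1 + g z.1 ^ 2) (μ.prod ν)) :
    ∫ a, (∫ b, f (a, b) ∂ν - g a) ^ 2 ∂μ
      = ∫ a, (∫ b, f (a, b) ∂ν) ^ 2 ∂μ
        + ∫ z, (-2 * f z * g z.1 + g z.1 ^ 2) ∂(μ.prod ν) := by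
  have hgf : MemLp (fun z : α × β => f z - g z.1) 2 (μ.prod ν) := by
    rw [memLp_two_iff_integrable_sq (by fun_prop)]
    exact (hf2.integrable_sq.add hh).congr (.of_forall fun z => by simp only [Pi.add_apply]; ring)
  have hg2' : MemLp (fun z : α × β => g z.1) 2 (μ.prod ν) :=
    (hf2.sub hgf).ae_eq (.of_forall fun z => by simp)
  have hg2 : MemLp g 2 μ := by
    rw [memLp_two_iff_integrable_sq hg.aestronglyMeasurable]
    exact (measurePreserving_fst (μ := μ) (ν := ν)).integrable_comp
      (hg.pow_const 2).aestronglyMeasurable |>.1 hg2'.integrable_sq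
  have hb := memLp_two_integral_prod hf hf2
  have hbg : Integrable (fun a => (∫ b, f (a, b) ∂ν) * g a) μ := hb.integrable_mul hg2
  have hf1 : Integrable f (μ.prod ν) := hf2.integrable one_le_two
  have e : ∫ z, (-2 * f z * g z.1 + g z.1 ^ 2) ∂(μ.prod ν)
      = ∫ a, (-2 * ((∫ b, f (a, b) ∂ν) * g a) + g a ^ 2) ∂μ := by
    rw [integral_prod _ hh]
    refine integral_congr_ae ?_
    filter_upwards [hf1.prod_right_ae] with a ha
    rw [integral_add ((ha.const_mul _).mul_const _) (integrable_const _), integral_mul_const,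
      integral_const_mul]
    simp only [integral_const, probReal_univ, one_smul]
    ring
  have hi : Integrable (fun a => -2 * ((∫ b, f (a, b) ∂ν) * g a) + g a ^ 2) μ :=
    (hbg.const_mul _).add hg2.integrable_sq
  rw [e, ← integral_add hb.integrable_sq hi]
  exact integral_congr_ae (.of_forall fun a => by simp only; ring)

variable {Ω 𝕋 𝕏 : Type*} [MeasurableSpace Ω] [MeasurableSpace 𝕋] [MeasurableSpace 𝕏]
  {P : Measure Ω} [IsProbabilityMeasure P] {T : Ω → 𝕋} {X : Ω → 𝕏} {Ypot : 𝕋 → Ω → ℝ}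
  {κ : Kernel (𝕋 × 𝕏) ℝ} [IsMarkovKernel κ]

/-- The dose-response function is the response function averaged over the law of the covariates. -/
theorem doseResponse_ae_eq (hT : Measurable T) (hX : Measurable X)
    (hκ : IsOutcomeMechanism P T X Ypot κ)
    (hY2 : Integrable (fun p => p.2 ^ 2) (interventionalLaw P T X κ)) :
    ∀ᵐ t ∂(P.map T), doseResponse P Ypot t = ∫ x, response κ (t, x) ∂(P.map X) := by
  have := Measure.isProbabilityMeasure_map (μ := P) hT.aemeasurable
  have := Measure.isProbabilityMeasure_map (μ := P) hX.aemeasurable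
  unfold interventionalLaw targetLaw at hY2
  have hY1 : Integrable (fun p : (𝕋 × 𝕏) × ℝ => p.2) (((P.map T).prod (P.map X)) ⊗ₘ κ) :=
    ((memLp_two_iff_integrable_sq measurable_snd.aestronglyMeasurable).2 hY2).integrable one_le_two
  obtain ⟨h1, h2⟩ := (Measure.integrable_compProd_iff hY1.1).1 hY1
  filter_upwards [hκ.potential, Measure.ae_ae_of_ae_prod h1, h2.prod_right_ae] with t ht h3 h4
  have hint : Integrable (fun p : 𝕏 × ℝ => p.2)
      ((P.map X) ⊗ₘ (κ.comap (fun x => (t, x)) measurable_prodMk_left)) :=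
    (Measure.integrable_compProd_iff measurable_snd.aestronglyMeasurable).2 ⟨h3, h4⟩
  have e : doseResponse P Ypot t
      = ∫ p, p.2 ∂((P.map X) ⊗ₘ (κ.comap (fun x => (t, x)) measurable_prodMk_left)) :=
    HasLaw.integral_comp (f := fun p : 𝕏 × ℝ => p.2) ht measurable_snd.aestronglyMeasurable
  rw [e, Measure.integral_compProd hint]
  rfl

theorem measurable_response (κ : Kernel (𝕋 × 𝕏) ℝ) : Measurable (response κ) :=
  (stronglyMeasurable_id.integral_kernel (κ := κ)).measurable

theorem causalRisk_eq (hT : Measurable T) (hX : Measurable X)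
    (hκ : IsOutcomeMechanism P T X Ypot κ)
    (hY2 : Integrable (fun p => p.2 ^ 2) (interventionalLaw P T X κ)) {g : 𝕋 → ℝ}
    (hg : Measurable g)
    (hh : Integrable (fun z : 𝕋 × 𝕏 => -2 * response κ z * g z.1 + g z.1 ^ 2)
      (targetLaw P T X)) :
    causalRisk P T Ypot g = ∫ t, (∫ x, response κ (t, x) ∂(P.map X)) ^ 2 ∂(P.map T)
      + ∫ z, (-2 * response κ z * g z.1 + g z.1 ^ 2) ∂(targetLaw P T X) := by
  have := Measure.isProbabilityMeasure_map (μ := P) hT.aemeasurable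
  have := Measure.isProbabilityMeasure_map (μ := P) hX.aemeasurable
  have hf2 : MemLp (response κ) 2 ((P.map T).prod (P.map X)) := memLp_two_integral_kernel hY2
  rw [targetLaw, ← integral_sq_sub_eq (measurable_response κ) hf2 hg hh]
  refine integral_congr_ae ?_
  filter_upwards [doseResponse_ae_eq hT hX hκ hY2] with t ht
  rw [ht]

end Risk

/-- A minimizer of the weighted risk satisfies the basic inequality with the noise split off. -/
theorem sum_le_of_weightedRisk_le {α : Type*} {n : ℕ} {w : Fin n → ℝ} {t : Fin n → α}
    {y : Fin n → ℝ} {g g' : α → ℝ} (h : weightedRisk w t y g ≤ weightedRisk w t y g')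
    (τ : Fin n → ℝ) :
    ∑ i, w i * (-2 * τ i * g (t i) + g (t i) ^ 2)
      ≤ ∑ i, w i * (-2 * τ i * g' (t i) + g' (t i) ^ 2)
        + 2 * ∑ i, w i * (y i - τ i) * (g (t i) - g' (t i)) := by
  have e : weightedRisk w t y g' - weightedRisk w t y g
      = ∑ i, w i * (-2 * τ i * g' (t i) + g' (t i) ^ 2)
        + 2 * ∑ i, w i * (y i - τ i) * (g (t i) - g' (t i))
        - ∑ i, w i * (-2 * τ i * g (t i) + g (t i) ^ 2) := by
    unfold weightedRisk
    rw [Finset.mul_sum, ← Finset.sum_add_distrib, ← Finset.sum_sub_distrib,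
      ← Finset.sum_sub_distrib]
    exact Finset.sum_congr rfl fun i _ => by ring
  linarith

theorem coe_le_coe_add_mul_of_forall {γ R A : ℝ} {I : ℝ≥0∞} (hγ : 0 ≤ γ)
    (h : γ = 0 ∨ I ≠ ∞ → R ≤ A + γ * I.toReal) :
    (R : EReal) ≤ (A : EReal) + (γ : EReal) * (I : EReal) := by
  by_cases hI : I = ∞
  · rcases hγ.eq_or_lt with h0 | h0
    · have := h (Or.inl h0.symm)
      rw [← h0] at this ⊢
      simpa using this
    · rw [hI, EReal.coe_ennreal_top, EReal.coe_mul_top_of_pos h0, EReal.coe_add_top]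
      exact le_top
  · have := h (Or.inr hI)
    lift I to NNReal using hI
    exact EReal.coe_le_coe_iff.2 this

end CausalBound

theorem mainTheorem1
    {Ω : Type*} [MeasurableSpace Ω] (P : Measure Ω) [IsProbabilityMeasure P] {dT dX : ℕ}
    (T : Ω → EuclideanSpace ℝ (Fin dT)) (hT : Measurable T)
    (X : Ω → EuclideanSpace ℝ (Fin dX)) (hX : Measurable X)
    (Ypot : EuclideanSpace ℝ (Fin dT) → Ω → ℝ) (hYpot : ∀ t, Measurable (Ypot t))
    (hY : Measurable (CausalBound.observedOutcome Ypot T))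
    (hign : CausalBound.Ignorability P T X Ypot)
    (κ : Kernel (EuclideanSpace ℝ (Fin dT) × EuclideanSpace ℝ (Fin dX)) ℝ) [IsMarkovKernel κ]
    (hκ : CausalBound.IsOutcomeMechanism P T X Ypot κ)
    (hY2 : Integrable (fun p => p.2 ^ 2) (CausalBound.interventionalLaw P T X κ))
    -- the two classes of functions
    (G : Set (EuclideanSpace ℝ (Fin dT) → ℝ)) (hG : ∀ g ∈ G, Measurable g)
    (F : Set (EuclideanSpace ℝ (Fin dT) × EuclideanSpace ℝ (Fin dX) → ℝ))
    (hF : ∀ f ∈ F, Measurable f ∧ Integrable f (CausalBound.targetLaw P T X))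
    (γ ε B : ℝ)
    (happrox : ∀ g ∈ G, CausalBound.Approximable ((P.map T).support ×ˢ (P.map X).support) F
      (γ / 2) (ε / 2) (fun z => -2 * CausalBound.response κ z * g z.1 + g z.1 ^ 2))
    (hB : CausalBound.IsBoundedClass (P.map T).support G B)
    -- the fixed data and the weights
    (n : ℕ) (hn : 0 < n)
    (t : Fin n → EuclideanSpace ℝ (Fin dT)) (ht : ∀ i, t i ∈ (P.map T).support)
    (x : Fin n → EuclideanSpace ℝ (Fin dX)) (hx : ∀ i, x i ∈ (P.map X).support)
    (M σ : ℝ) (hσ : 0 ≤ σ)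
    (hM : ∀ i, ∀ᵐ y ∂(κ (t i, x i)), |y - CausalBound.response κ (t i, x i)| ≤ M / 2)
    (hvar : ∀ i, Var[id; κ (t i, x i)] ≤ σ ^ 2)
    (w : Fin n → ℝ) (hw : w ∈ stdSimplex ℝ (Fin n)) (W : ℝ) (hW : ∀ i, w i ≤ W / n)
    (δ : ℝ) (hδ : 0 < δ) (hδ1 : δ ≤ 1) :
    ∃ E : Set (Fin n → ℝ), MeasurableSet E ∧
      ENNReal.ofReal (1 - δ) ≤ CausalBound.outcomesLaw κ (fun i => (t i, x i)) E ∧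
      ∀ y ∈ E, ∀ ghat ∈ G, IsMinOn (CausalBound.weightedRisk w t y) G ghat →
        ((CausalBound.causalRisk P T Ypot ghat : ℝ) : EReal) ≤
          (((⨅ g : G, CausalBound.causalRisk P T Ypot g)
            + W * M * (CausalBound.rademacherComplexity G t
                + CausalBound.Bdelta B δ ^ 2 / (12 * B * n))
            + σ * CausalBound.Bdelta B δ * √(∑ i, w i ^ 2) + 2 * ε : ℝ) : EReal)
          + (γ : EReal) * ((CausalBound.IPM F
              (CausalBound.weightedEmpirical w fun i => (t i, x i))
              (CausalBound.targetLaw P T X) : ℝ≥0∞) : EReal) := by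
  rcases G.eq_empty_or_nonempty with rfl | hne
  · exact ⟨Set.univ, MeasurableSet.univ, by
      simp only [CausalBound.outcomesLaw, measure_univ, ENNReal.ofReal_le_one]; linarith,
      fun y _ g hg => by simp at hg⟩
  have := Measure.isProbabilityMeasure_map (μ := P) hT.aemeasurable
  have := Measure.isProbabilityMeasure_map (μ := P) hX.aemeasurable
  have : IsProbabilityMeasure (CausalBound.targetLaw P T X) := by
    unfold CausalBound.targetLaw; infer_instance
  obtain ⟨E, hE, hPE, hnoise⟩ := CausalBound.exists_event_noise_le (t := t) hn hne
    (fun g hg g' hg' i => hB g hg g' hg' _ (ht i)) (fun i => κ (t i, x i)) hσ hM hvar hw hW hδ hδ1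
  refine ⟨E, hE, hPE, fun y hy ghat hghat hmin => ?_⟩
  have hγ : 0 ≤ γ := by
    have := (happrox ghat hghat).nonneg_left
    linarith
  have hD : ∀ᵐ z ∂(CausalBound.targetLaw P T X),
      z ∈ (P.map T).support ×ˢ (P.map X).support := by
    have h1 : ∀ᵐ z ∂(CausalBound.targetLaw P T X), z.1 ∈ (P.map T).support :=
      Measure.quasiMeasurePreserving_fst.ae Measure.support_mem_ae
    have h2 : ∀ᵐ z ∂(CausalBound.targetLaw P T X), z.2 ∈ (P.map X).support :=
      Measure.quasiMeasurePreserving_snd.ae Measure.support_mem_ae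
    filter_upwards [h1, h2] with z hz1 hz2 using ⟨hz1, hz2⟩
  have hmeas : ∀ g ∈ G, Measurable fun z : EuclideanSpace ℝ (Fin dT) × EuclideanSpace ℝ (Fin dX) =>
      -2 * CausalBound.response κ z * g z.1 + g z.1 ^ 2 := fun g hg => by
    have h1 : Measurable fun z : EuclideanSpace ℝ (Fin dT) × EuclideanSpace ℝ (Fin dX) => g z.1 :=
      (hG g hg).comp measurable_fst
    exact (((CausalBound.measurable_response κ).const_mul _).mul h1).add (h1.pow_const 2)
  have hrisk : ∀ g ∈ G, _ := fun g hg => CausalBound.causalRisk_eq hT hX hκ hY2 (hG g hg)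
    ((happrox g hg).integrable (hmeas g hg) (fun f hf => (hF f hf).2) hD)
  refine CausalBound.coe_le_coe_add_mul_of_forall hγ fun hI => ?_
  have hdisc := fun g (hg : g ∈ G) => (happrox g hg).abs_sum_sub_integral_le (hmeas g hg) hF hD hw
    (z := fun i => (t i, x i)) (fun i => ⟨ht i, hx i⟩) (hI.imp (fun h => by simp [h]) id)
  have hkey : ∀ g : G, CausalBound.causalRisk P T Ypot ghat
      - (W * M * (CausalBound.rademacherComplexity G t
          + CausalBound.Bdelta B δ ^ 2 / (12 * B * n))
        + σ * CausalBound.Bdelta B δ * √(∑ i, w i ^ 2) + 2 * ε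
        + γ * (CausalBound.IPM F (CausalBound.weightedEmpirical w fun i => (t i, x i))
            (CausalBound.targetLaw P T X)).toReal) ≤ CausalBound.causalRisk P T Ypot g := by
    rintro ⟨g, hg⟩
    have h1 := CausalBound.sum_le_of_weightedRisk_le (hmin hg)
      (fun i => CausalBound.response κ (t i, x i))
    have h2 := hnoise y hy ghat hghat g hg
    have h3 := (abs_le.1 (hdisc ghat hghat)).1
    have h4 := (abs_le.1 (hdisc g hg)).2
    rw [hrisk ghat hghat, hrisk g hg]
    simp only [CausalBound.response] at h1 h2 h3 h4 ⊢
    linarith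
  have := hne.to_subtype
  have := le_ciInf hkey
  linarith
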